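/- Let $m=2\ell$ be an even nonnegative integer, and let $C^{(m)}=(c_{ij})_{1\le i,j\le m}$ be the $m\times m$ matrix with $c_{ij}=1$ if $i+j\le m+1$, except that $c_{ij}=0$ when $i+j=m$ and $i,j$ are both odd, and with $c_{ij}=0$ if $i+j>m+1$. For $n\ge 1$ let $t_{C^{(m)}}(n)$ be the number of plane trees (rooted ordered trees) with $n$ vertices in which every vertex is given one of the colors $1,\dots,m$ such that a vertex of color $j$ can be a child of a vertex of color $i$ only if $c_{ij}=1$; two colored trees are counted as different if they differ in the tree or in the colors. Then, for every $\ell$ and every $n\ge 1$, $$t_{C^{(m)}}(n)=\frac{\ell}{n}\cdot 2^{2n-1}\binom{\frac{\ell+1}{2}\,n-\frac{\ell}{2}-1}{n-1},$$ where $\binom{x}{k}=\frac{x(x-1)\cdots(x-k+1)}{k!}$ for rational $x$ and integers $k\ge 0$. -/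

import Mathlib

/-- A plane tree (a nonempty rooted tree in which the children of every vertex are linearly
ordered from left to right) with a colour from `κ` on every vertex: a root colour together with
the ordered list of the subtrees that hang from the root. -/
inductive ColoredPlaneTree (κ : Type) : Type where
  | node (color : κ) (children : List (ColoredPlaneTree κ)) : ColoredPlaneTree κ

namespace ColoredPlaneTree

/-- The colour of the root. -/
def rootColor {κ : Type} : ColoredPlaneTree κ → κ
  | node c _ => c

/-- The number of vertices: the root plus the vertices of all the subtrees of the root. -/
def numVertices {κ : Type} : ColoredPlaneTree κ → ℕ
  | node _ ts => 1 + (ts.map numVertices).sum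

/-- The coloring rule given by a zero-one matrix `A`: a vertex of colour `j` can only be a child
of a vertex of colour `i` if `A i j = 1`. -/
inductive FollowsRule {κ : Type} (A : Matrix κ κ ℕ) : ColoredPlaneTree κ → Prop where
  | node (i : κ) (ts : List (ColoredPlaneTree κ))
      (hroot : ∀ t ∈ ts, A i t.rootColor = 1)
      (hsub : ∀ t ∈ ts, FollowsRule A t) : FollowsRule A (ColoredPlaneTree.node i ts)

theorem numVertices_node {κ : Type} (c : κ) (ts : List (ColoredPlaneTree κ)) :
    (node c ts).numVertices = 1 + (ts.map numVertices).sum := by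
  rw [numVertices]

theorem one_le_numVertices {κ : Type} (t : ColoredPlaneTree κ) : 1 ≤ t.numVertices := by
  cases t with
  | node c ts => rw [numVertices_node]; omega

/-- With finitely many colours there are finitely many coloured plane trees of bounded size. -/
theorem finite_setOf_numVertices_le {κ : Type} [Finite κ] (n : ℕ) :
    {t : ColoredPlaneTree κ | t.numVertices ≤ n}.Finite := by
  induction n with
  | zero =>
    refine Set.Finite.subset Set.finite_empty ?_
    intro t ht
    have h1 := one_le_numVertices t
    have h2 : t.numVertices ≤ 0 := ht
    omega
  | succ n ih =>
    have : Finite {t : ColoredPlaneTree κ | t.numVertices ≤ n} := ih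
    have hL := List.finite_length_le {t : ColoredPlaneTree κ | t.numVertices ≤ n} n
    refine ((Set.finite_univ (α := κ)).prod hL |>.image
      (fun p => node p.1 (p.2.map Subtype.val))).subset ?_
    rintro ⟨c, ts⟩ ht
    have ht' : (node c ts).numVertices ≤ n + 1 := ht
    rw [numVertices_node] at ht'
    have hs : (ts.map numVertices).sum ≤ n := by omega
    have hmem : ∀ t ∈ ts, t ∈ {t : ColoredPlaneTree κ | t.numVertices ≤ n} := fun t h =>
      (List.single_le_sum (by simp) _ (List.mem_map_of_mem h)).trans hs
    have hlen : ts.length ≤ n := by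
      have := List.length_le_sum_of_one_le (ts.map numVertices) (by
        intro i hi
        obtain ⟨t, -, rfl⟩ := List.mem_map.1 hi
        exact one_le_numVertices t)
      rw [List.length_map] at this
      exact this.trans hs
    refine ⟨(c, ts.attach.map fun t => ⟨t.1, hmem t.1 t.2⟩), ?_, ?_⟩
    · simpa using hlen
    · simp [List.map_map, Function.comp_def]

end ColoredPlaneTree

/-- The set of plane trees with `n` vertices that are coloured with the colours `κ` according to
the rule given by `A`. -/
def treesFollowing {κ : Type} (A : Matrix κ κ ℕ) (n : ℕ) : Set (ColoredPlaneTree κ) :=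
  {t | t.numVertices = n ∧ t.FollowsRule A}

/-- For finitely many colours this set is finite, so that `Set.ncard` really counts it. -/
theorem finite_treesFollowing {κ : Type} [Finite κ] (A : Matrix κ κ ℕ) (n : ℕ) :
    (treesFollowing A n).Finite :=
  (ColoredPlaneTree.finite_setOf_numVertices_le n).subset fun _ ht => ht.1.le

/-- The number `t_A(n)` of plane trees with `n` vertices coloured according to the rule `A`. -/
noncomputable def treeCount {κ : Type} (A : Matrix κ κ ℕ) (n : ℕ) : ℕ :=
  (treesFollowing A n).ncard

/-- The `m × m` zero-one matrix whose `(i, j)` entry is `1` iff `i + j ≤ m + 1`, except when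
`i + j = m` and both `i` and `j` are odd. Here `1 ≤ i, j ≤ m`; the index `a : Fin m` stands for the
colour `a + 1`. -/
def variantMatrix (m : ℕ) : Matrix (Fin m) (Fin m) ℕ :=
  Matrix.of fun a b =>
    let i : ℕ := (a : ℕ) + 1
    let j : ℕ := (b : ℕ) + 1
    if i + j ≤ m + 1 ∧ ¬ (i + j = m ∧ Odd i ∧ Odd j) then 1 else 0

/-!
For a colour `i`, let `F i` be the generating function of the coloured trees with root colour `i`.
Cutting off the leftmost subtree of the root (the inverse of `ColoredPlaneTree.graft`) gives the
system `F i = X + F i * ∑ j, c i j * F j` (`rootedSeries_eq`). Over any power series ring, and with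
any `g` in place of `X`, such a system has only one solution without constant terms
(`eq_of_system`).

The system for `variantMatrix (2 * l)` can be solved explicitly after a change of variable. Put
`w = (1 + X) ^ (-1 / 2)` and `g = (w ^ (l - 1) - w ^ (l + 1)) / 4 = X * w ^ (l + 1) / 4`. Then the
colours `2 * k + 1` and `2 * k + 2` have the same series, namely
`F (g) = (w ^ k - w ^ (k + 1)) / 2`. Indeed the partial sums of these series telescope: for a root
of either colour, the allowed colours of a child contribute `1 - (w ^ p + w ^ (p + 1)) / 2` with
`k + p = l - 1`, and `(w ^ k - w ^ (k + 1)) * (w ^ p + w ^ (p + 1)) / 4 = g`; this is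
`pairSeries_eq`. Summing over all colours, the generating function `T` of all trees satisfies
`T (g) = 1 - w ^ l`.

Lagrange inversion (`lagrange_inversion`) now extracts the coefficients. With
`φ = X / g = 4 * (1 + X) ^ ((l + 1) / 2)` and `(1 - w ^ l)' = l / 2 * w ^ (l + 2)`, the number
`n * [X ^ n] T` is the coefficient of `X ^ (n - 1)` in
`l / 2 * 4 ^ n * (1 + X) ^ ((l + 1) / 2 * n - l / 2 - 1)`.
-/

/-! ### The recursion for coloured trees with a given root colour -/

namespace ColoredPlaneTree

/-- Hang a second tree below the root of a first one, as its new leftmost subtree. -/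
def graft {κ : Type} (p : ColoredPlaneTree κ × ColoredPlaneTree κ) : ColoredPlaneTree κ :=
  match p.1 with
  | node c ts => node c (p.2 :: ts)

theorem graft_node {κ : Type} (c : κ) (ts : List (ColoredPlaneTree κ)) (t : ColoredPlaneTree κ) :
    graft (node c ts, t) = node c (t :: ts) := rfl

theorem graft_injective {κ : Type} :
    Function.Injective (graft : ColoredPlaneTree κ × ColoredPlaneTree κ → _) := by
  rintro ⟨⟨c, ts⟩, t⟩ ⟨⟨c', ts'⟩, t'⟩ h
  simp only [graft_node, node.injEq, List.cons.injEq] at h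
  obtain ⟨rfl, rfl, rfl⟩ := h
  rfl

theorem followsRule_node_iff {κ : Type} (A : Matrix κ κ ℕ) (i : κ)
    (ts : List (ColoredPlaneTree κ)) :
    (node i ts).FollowsRule A ↔
      (∀ t ∈ ts, A i t.rootColor = 1) ∧ ∀ t ∈ ts, t.FollowsRule A := by
  refine ⟨fun h => ?_, fun h => .node i ts h.1 h.2⟩
  cases h with
  | node _ _ h1 h2 => exact ⟨h1, h2⟩

end ColoredPlaneTree

open ColoredPlaneTree in
/-- The finite set of trees with `n` vertices and root colour `i` that follow the rule `A`. -/
noncomputable def rootedTrees {κ : Type} [Finite κ] (A : Matrix κ κ ℕ) (i : κ) (n : ℕ) :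
    Finset (ColoredPlaneTree κ) :=
  ((finite_treesFollowing A n).subset
    (Set.inter_subset_left : treesFollowing A n ∩ {t | t.rootColor = i} ⊆ _)).toFinset

theorem mem_rootedTrees {κ : Type} [Finite κ] {A : Matrix κ κ ℕ} {i : κ} {n : ℕ}
    {t : ColoredPlaneTree κ} :
    t ∈ rootedTrees A i n ↔ (t.numVertices = n ∧ t.FollowsRule A) ∧ t.rootColor = i := by
  simp [rootedTrees, treesFollowing]

theorem treeCount_eq_sum_card_rootedTrees {κ : Type} [Fintype κ] (A : Matrix κ κ ℕ) (n : ℕ) :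
    treeCount A n = ∑ i, (rootedTrees A i n).card := by
  classical
  have h : treesFollowing A n = ↑(Finset.univ.biUnion fun i => rootedTrees A i n) := by
    ext t
    simp [mem_rootedTrees, treesFollowing]
  rw [treeCount, h, Set.ncard_coe_finset, Finset.card_biUnion]
  intro i _ j _ hij
  refine Finset.disjoint_left.2 fun t ht ht' => hij ?_
  rw [← (mem_rootedTrees.1 ht).2, (mem_rootedTrees.1 ht').2]

open ColoredPlaneTree in
/-- A tree is a single vertex, or it arises in exactly one way by grafting. -/
theorem card_rootedTrees {κ : Type} [Fintype κ] (A : Matrix κ κ ℕ) (i : κ) (n : ℕ) :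
    (rootedTrees A i n).card = (if n = 1 then 1 else 0) +
      ∑ p ∈ Finset.HasAntidiagonal.antidiagonal n, (rootedTrees A i p.1).card *
        ∑ j, if A i j = 1 then (rootedTrees A j p.2).card else 0 := by
  classical
  set L : Finset (ColoredPlaneTree κ) := if n = 1 then {node i []} else ∅ with hL
  set P : Finset (ColoredPlaneTree κ × ColoredPlaneTree κ) :=
    (Finset.HasAntidiagonal.antidiagonal n).biUnion fun p =>
      (Finset.univ.filter fun j => A i j = 1).biUnion fun j => rootedTrees A i p.1 ×ˢ rootedTrees A j p.2 with hP
  have hS : rootedTrees A i n = L ∪ P.image graft := by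
    ext ⟨c, ts⟩
    simp only [mem_rootedTrees, numVertices_node, followsRule_node_iff, rootColor,
      Finset.mem_union, Finset.mem_image, hP, Finset.mem_biUnion, Finset.mem_product,
      Finset.mem_filter, Finset.mem_univ, true_and, Finset.HasAntidiagonal.mem_antidiagonal,
      Prod.exists]
    constructor
    · rintro ⟨⟨hn, h1, h2⟩, rfl⟩
      cases ts with
      | nil =>
        left
        simp only [List.map_nil, List.sum_nil, add_zero] at hn
        simp [hL, ← hn]
      | cons t ts =>
        right
        simp only [List.mem_cons, forall_eq_or_imp] at h1 h2
        simp only [List.map_cons, List.sum_cons] at hn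
        refine ⟨node c ts, t, ⟨1 + (ts.map numVertices).sum, t.numVertices, by omega,
          t.rootColor, h1.1, ⟨⟨numVertices_node _ _, ?_⟩, rfl⟩, ⟨rfl, h2.1⟩, rfl⟩, rfl⟩
        exact (followsRule_node_iff A c ts).2 ⟨h1.2, h2.2⟩
    · rintro (h | ⟨⟨c', ts'⟩, t, ⟨a, b, hab, j, hj, ⟨⟨ha, hf⟩, hc⟩, ⟨hb, hf'⟩, hc'⟩, he⟩)
      · rw [hL] at h
        split_ifs at h with h1
        · simp only [Finset.mem_singleton, node.injEq] at h
          obtain ⟨rfl, rfl⟩ := h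
          simp [h1]
        · simp at h
      · rw [graft_node] at he
        simp only [node.injEq] at he
        obtain ⟨rfl, rfl⟩ := he
        have hc2 : c' = i := hc
        subst hc2 hc'
        rw [numVertices_node] at ha
        rw [followsRule_node_iff] at hf
        refine ⟨⟨?_, ?_, ?_⟩, rfl⟩
        · simp only [List.map_cons, List.sum_cons]
          omega
        · simpa using ⟨hj, hf.1⟩
        · simpa using ⟨hf', hf.2⟩
  have hdisj : Disjoint L (P.image graft) := by
    refine Finset.disjoint_left.2 fun t ht ht' => ?_
    obtain ⟨⟨⟨c, ts⟩, s⟩, -, rfl⟩ := Finset.mem_image.1 ht'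
    rw [hL] at ht
    split_ifs at ht <;> simp [graft_node] at ht
  have hLc : L.card = if n = 1 then 1 else 0 := by
    rw [hL]
    split_ifs <;> simp
  rw [hS, Finset.card_union_of_disjoint hdisj, hLc, Finset.card_image_of_injective _ graft_injective,
    hP, Finset.card_biUnion]
  · congr 1
    refine Finset.sum_congr rfl fun p _ => ?_
    rw [Finset.card_biUnion]
    · simp only [Finset.card_product, Finset.sum_filter, Finset.mul_sum, mul_ite, mul_zero]
    · intro j _ j' _ hjj
      refine Finset.disjoint_left.2 fun t ht ht' => hjj ?_
      rw [Finset.mem_product, mem_rootedTrees, mem_rootedTrees] at ht ht'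
      rw [← ht.2.2, ht'.2.2]
  · intro p _ q _ hpq
    refine Finset.disjoint_left.2 fun t ht ht' => hpq ?_
    simp only [Finset.mem_biUnion, Finset.mem_product, mem_rootedTrees] at ht ht'
    obtain ⟨j, -, ⟨⟨h1, -⟩, -⟩, ⟨h2, -⟩, -⟩ := ht
    obtain ⟨j', -, ⟨⟨h1', -⟩, -⟩, ⟨h2', -⟩, -⟩ := ht'
    exact Prod.ext (h1.symm.trans h1') (h2.symm.trans h2')

open PowerSeries

/-- The generating function, by the number of vertices, of the trees with root colour `i` that
follow the rule `A`. -/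
noncomputable def rootedSeries {κ : Type} [Finite κ] (A : Matrix κ κ ℕ) (i : κ) : ℚ⟦X⟧ :=
  PowerSeries.mk fun n => ((rootedTrees A i n).card : ℚ)

theorem rootedSeries_eq {κ : Type} [Fintype κ] (A : Matrix κ κ ℕ) (i : κ) :
    rootedSeries A i =
      X + rootedSeries A i * ∑ j, if A i j = 1 then rootedSeries A j else 0 := by
  ext n
  rw [map_add, coeff_X, coeff_mul, rootedSeries, coeff_mk, card_rootedTrees]
  push_cast
  congr 1
  refine Finset.sum_congr rfl fun p _ => ?_
  rw [coeff_mk, map_sum]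
  congr 1
  refine Finset.sum_congr rfl fun j _ => ?_
  split_ifs <;> simp [rootedSeries]

theorem constantCoeff_rootedSeries {κ : Type} [Finite κ] (A : Matrix κ κ ℕ) (i : κ) :
    constantCoeff (rootedSeries A i) = 0 := by
  rw [← coeff_zero_eq_constantCoeff_apply, rootedSeries, coeff_mk, Nat.cast_eq_zero,
    Finset.card_eq_zero, Finset.eq_empty_iff_forall_notMem]
  intro t ht
  have h1 := (mem_rootedTrees.1 ht).1.1
  have h2 := t.one_le_numVertices
  omega


/-! ### Lagrange inversion -/

/-- The residue computation behind Lagrange inversion: `g' / g ^ (d + 1)` is the derivative of a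
Laurent series when `d ≠ 0`, so it has no residue; here `g = X * ψ` and `φ = 1 / ψ`. -/
theorem coeff_derivative_mul_pow {φ ψ : ℚ⟦X⟧} (h : φ * ψ = 1) (d : ℕ) :
    coeff d (d⁄dX ℚ (X * ψ) * φ ^ (d + 1)) = if d = 0 then 1 else 0 := by
  have hg : d⁄dX ℚ (X * ψ) = ψ + X * d⁄dX ℚ ψ := by
    rw [Derivation.leibniz, derivative_X, smul_eq_mul, smul_eq_mul]
    ring
  have h' : φ * d⁄dX ℚ ψ + ψ * d⁄dX ℚ φ = 0 := by
    have := congrArg (d⁄dX ℚ) h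
    rwa [Derivation.leibniz, derivative_one, smul_eq_mul, smul_eq_mul] at this
  rcases d with _ | d
  · have : d⁄dX ℚ (X * ψ) * φ ^ (0 + 1) = 1 + X * (d⁄dX ℚ ψ * φ) := by
      rw [hg]
      linear_combination h
    rw [this]
    simp
  · have : d⁄dX ℚ (X * ψ) * φ ^ (d + 1 + 1) = φ ^ (d + 1) - X * (φ ^ d * d⁄dX ℚ φ) := by
      rw [hg]
      linear_combination (φ ^ (d + 1) - X * φ ^ d * d⁄dX ℚ φ) * h + X * φ ^ (d + 1) * h'
    have hp : ((d : ℚ) + 1) * coeff d (φ ^ d * d⁄dX ℚ φ) =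
        coeff (d + 1) (φ ^ (d + 1)) * (d + 1) := by
      rw [← coeff_derivative, derivative_pow, ← coeff_C_mul]
      simp [mul_assoc]
    have hd : (d : ℚ) + 1 ≠ 0 := by positivity
    rw [this, map_sub, coeff_succ_X_mul, if_neg (by omega)]
    apply mul_left_cancel₀ hd
    linear_combination -hp

/-- Only the term of degree `n` of `S` contributes to the residue of `S (g) * g' / g ^ (n + 1)`,
where `g = X * ψ`; the other terms are split off one at a time. -/
theorem coeff_subst_mul_derivative_mul_pow {φ ψ : ℚ⟦X⟧} (h : φ * ψ = 1) (n : ℕ) (S : ℚ⟦X⟧) :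
    coeff n (S.subst (X * ψ) * d⁄dX ℚ (X * ψ) * φ ^ (n + 1)) = coeff n S := by
  have hs : HasSubst (X * ψ) := HasSubst.of_constantCoeff_zero' (by simp)
  induction n generalizing S with
  | zero =>
    obtain ⟨S', c, hS⟩ : ∃ S' c, S = X * S' + C c := ⟨_, _, S.eq_X_mul_shift_add_const⟩
    have hsub : S.subst (X * ψ) = X * ψ * S'.subst (X * ψ) + C c := by
      rw [hS, subst_add hs, subst_mul hs, subst_X hs, subst_C]
      rfl
    have h0 := coeff_derivative_mul_pow h 0
    rw [if_pos rfl, coeff_zero_eq_constantCoeff_apply] at h0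
    rw [mul_assoc, coeff_zero_eq_constantCoeff_apply, map_mul, h0, hsub, hS]
    simp
  | succ n ih =>
    obtain ⟨S', c, hS⟩ : ∃ S' c, S = X * S' + C c := ⟨_, _, S.eq_X_mul_shift_add_const⟩
    have hsub : S.subst (X * ψ) = X * ψ * S'.subst (X * ψ) + C c := by
      rw [hS, subst_add hs, subst_mul hs, subst_X hs, subst_C]
      rfl
    have : S.subst (X * ψ) * d⁄dX ℚ (X * ψ) * φ ^ (n + 1 + 1) =
        X * (S'.subst (X * ψ) * d⁄dX ℚ (X * ψ) * φ ^ (n + 1)) +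
          C c * (d⁄dX ℚ (X * ψ) * φ ^ (n + 1 + 1)) := by
      rw [hsub]
      linear_combination X * S'.subst (X * ψ) * d⁄dX ℚ (X * ψ) * φ ^ (n + 1) * h
    rw [this, map_add, coeff_succ_X_mul, ih, coeff_C_mul, coeff_derivative_mul_pow h, hS]
    simp

/-- Lagrange inversion: if `T (g) = H` with `g = X / φ`, then
`n * [X ^ n] T = [X ^ (n - 1)] H' * φ ^ n`. -/
theorem lagrange_inversion {φ ψ : ℚ⟦X⟧} (h : φ * ψ = 1) (T : ℚ⟦X⟧) (n : ℕ) :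
    coeff (n + 1) T * (n + 1) = coeff n (d⁄dX ℚ (T.subst (X * ψ)) * φ ^ (n + 1)) := by
  rw [derivative_subst (HasSubst.of_constantCoeff_zero' (by simp)),
    coeff_subst_mul_derivative_mul_pow h, coeff_derivative]

/-! ### Uniqueness of the solution of the system -/

/-- The system of equations for the generating functions has at most one solution without
constant terms: the lowest coefficients of two solutions determine the next ones. -/
theorem eq_of_system {κ R : Type} [Fintype κ] [CommRing R] (A : Matrix κ κ ℕ)
    (g : R⟦X⟧) (F G : κ → R⟦X⟧)
    (hF0 : ∀ i, constantCoeff (F i) = 0) (hG0 : ∀ i, constantCoeff (G i) = 0)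
    (hF : ∀ i, F i = g + F i * ∑ j, if A i j = 1 then F j else 0)
    (hG : ∀ i, G i = g + G i * ∑ j, if A i j = 1 then G j else 0) : F = G := by
  have key : ∀ k i, (X : R⟦X⟧) ^ k ∣ F i - G i := by
    intro k
    induction k with
    | zero => simp
    | succ k ih =>
      intro i
      have hsum : (∑ j, if A i j = 1 then F j else 0) - (∑ j, if A i j = 1 then G j else 0) =
          ∑ j, if A i j = 1 then F j - G j else 0 := by
        rw [← Finset.sum_sub_distrib]
        exact Finset.sum_congr rfl fun j _ => by split_ifs <;> simp
      have h1 : (X : R⟦X⟧) ∣ ∑ j, if A i j = 1 then F j else 0 :=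
        Finset.dvd_sum fun j _ => by
          split_ifs
          · exact X_dvd_iff.2 (hF0 j)
          · exact dvd_zero _
      have h2 : (X : R⟦X⟧) ^ k ∣ ∑ j, if A i j = 1 then F j - G j else 0 :=
        Finset.dvd_sum fun j _ => by
          split_ifs
          · exact ih j
          · exact dvd_zero _
      have h3 : F i - G i = (F i - G i) * (∑ j, if A i j = 1 then F j else 0) +
          (∑ j, if A i j = 1 then F j - G j else 0) * G i := by
        rw [← hsum]
        linear_combination hF i - hG i
      rw [h3, pow_succ]
      exact dvd_add (mul_dvd_mul (ih i) h1) (mul_dvd_mul h2 (X_dvd_iff.2 (hG0 i)))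
  funext i
  refine sub_eq_zero.1 (PowerSeries.ext fun n => ?_)
  rw [X_pow_dvd_iff.1 (key (n + 1) i) n n.lt_succ_self, map_zero]

/-! ### The explicit solution -/

theorem PowerSeries.binomialSeries_pow (r : ℚ) (k : ℕ) :
    (PowerSeries.binomialSeries ℚ r) ^ k = PowerSeries.binomialSeries ℚ (k * r) := by
  induction k with
  | zero => simp
  | succ k ih =>
    rw [pow_succ, ih, ← binomialSeries_add]
    congr 1
    push_cast
    ring

theorem sum_range_two_mul {M : Type*} [AddCommMonoid M] (f : ℕ → M) (l : ℕ) :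
    ∑ a ∈ Finset.range (2 * l), f a = ∑ b ∈ Finset.range l, (f (2 * b) + f (2 * b + 1)) := by
  induction l with
  | zero => simp
  | succ l ih =>
    rw [show 2 * (l + 1) = 2 * l + 1 + 1 by ring, Finset.sum_range_succ, Finset.sum_range_succ, ih,
      Finset.sum_range_succ, add_assoc]

/-- The formal power series `(1 + X) ^ (-1 / 2)`. -/
noncomputable def invSqrtSeries : ℚ⟦X⟧ := PowerSeries.binomialSeries ℚ (-1 / 2 : ℚ)

theorem invSqrtSeries_sq : invSqrtSeries ^ 2 * (1 + X) = 1 := by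
  have h : (1 + X : ℚ⟦X⟧) = PowerSeries.binomialSeries ℚ (1 : ℚ) := by
    simpa using (binomialSeries_nat (R := ℚ) (A := ℚ) 1).symm
  rw [invSqrtSeries, binomialSeries_pow, h, ← binomialSeries_add]
  norm_num

theorem derivative_invSqrtSeries :
    d⁄dX ℚ invSqrtSeries = -(C (1 / 2) * invSqrtSeries ^ 3) := by
  set w := invSqrtSeries with hw
  have h2 : (C (1 / 2) : ℚ⟦X⟧) * 2 = 1 := by
    rw [← map_ofNat (C (R := ℚ)) 2, ← map_mul]; norm_num
  have h := invSqrtSeries_sq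
  rw [← hw] at h
  have h' := congrArg (d⁄dX ℚ) h
  rw [Derivation.leibniz, derivative_pow, map_add, derivative_X, derivative_one] at h'
  simp only [smul_eq_mul, Nat.cast_ofNat] at h'
  linear_combination (C (1 / 2) * w) * h' - (C (1 / 2) * 2 * d⁄dX ℚ w) * h
    - (d⁄dX ℚ w) * h2

/-- The common value, after the change of variable, of the generating functions of the two root
colours `2 * k + 1` and `2 * k + 2`. -/
noncomputable def pairSeries (k : ℕ) : ℚ⟦X⟧ :=
  C (1 / 2) * (invSqrtSeries ^ k - invSqrtSeries ^ (k + 1))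

theorem pairSeries_add_self (k : ℕ) :
    pairSeries k + pairSeries k = invSqrtSeries ^ k - invSqrtSeries ^ (k + 1) := by
  have h2 : (C (1 / 2) : ℚ⟦X⟧) * 2 = 1 := by
    rw [← map_ofNat (C (R := ℚ)) 2, ← map_mul]; norm_num
  rw [pairSeries]
  linear_combination (invSqrtSeries ^ k - invSqrtSeries ^ (k + 1)) * h2

theorem sum_pairSeries (q : ℕ) :
    ∑ b ∈ Finset.range q, (pairSeries b + pairSeries b) = 1 - invSqrtSeries ^ q := by
  simp only [pairSeries_add_self]
  simpa using Finset.sum_range_sub' (fun b => invSqrtSeries ^ b) q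

/-- Among the colours `2 * b + 1` and `2 * b + 2`, the colour `a + 1` allows both as children if
`a / 2 + b < l - 1`, exactly one if `a / 2 + b = l - 1`, and none otherwise, so
the sum telescopes. -/
theorem sum_variantMatrix_pairSeries (l : ℕ) (a : Fin (2 * l)) :
    (∑ j : Fin (2 * l), if variantMatrix (2 * l) a j = 1 then pairSeries (j / 2) else 0) =
      1 - invSqrtSeries ^ (l - 1 - a / 2) + pairSeries (l - 1 - a / 2) := by
  obtain ⟨p, hp⟩ : ∃ p, p = l - 1 - (a : ℕ) / 2 := ⟨_, rfl⟩
  have ha := a.2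
  obtain ⟨f, hf⟩ : ∃ f : ℕ → ℚ⟦X⟧, f = fun b => if (a : ℕ) + 1 + (b + 1) ≤ 2 * l + 1 ∧
      ¬ ((a : ℕ) + 1 + (b + 1) = 2 * l ∧ Odd ((a : ℕ) + 1) ∧ Odd (b + 1))
      then pairSeries (b / 2) else 0 := ⟨_, rfl⟩
  have e : ∀ j : Fin (2 * l), (if variantMatrix (2 * l) a j = 1 then pairSeries (j / 2) else 0) =
      f j := by
    intro j
    simp only [variantMatrix, Matrix.of_apply, hf]
    congr 1
    simp
  rw [Finset.sum_congr rfl fun j _ => e j, ← Finset.sum_range f, sum_range_two_mul, ← hp]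
  have t : ∀ b ∈ Finset.range l, f (2 * b) + f (2 * b + 1) =
      (if b < p then pairSeries b + pairSeries b else 0) +
      (if b = p then pairSeries b else 0) := by
    intro b hb
    rw [Finset.mem_range] at hb
    simp only [hf, show 2 * b / 2 = b by omega, show (2 * b + 1) / 2 = b by omega, Nat.odd_iff]
    rcases lt_trichotomy b p with h | h | h
    · rw [if_pos (by omega), if_pos (by omega), if_pos h, if_neg (by omega), add_zero]
    · rw [if_neg (by omega : ¬ b < p), if_pos h]
      rcases Nat.mod_two_eq_zero_or_one a with h0 | h0
      · rw [if_neg (by omega), if_pos (by omega)]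
      · rw [if_pos (by omega), if_neg (by omega), add_comm]
    · rw [if_neg (by omega), if_neg (by omega), if_neg (by omega), if_neg (by omega)]
  rw [Finset.sum_congr rfl t, Finset.sum_add_distrib, ← Finset.sum_filter,
    Finset.sum_ite_eq' (Finset.range l) p, if_pos (Finset.mem_range.2 (by omega)),
    ← sum_pairSeries]
  congr 2
  ext b
  simp only [Finset.mem_filter, Finset.mem_range]
  omega

/-- The series `pairSeries` solve the system of `variantMatrix (2 * l)` with
`X * (w ^ (l + 1) / 4)` in place of `X`, where `w = invSqrtSeries`. -/
theorem pairSeries_eq (l : ℕ) (a : Fin (2 * l)) :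
    pairSeries (a / 2) = X * (C (1 / 4) * invSqrtSeries ^ (l + 1)) + pairSeries (a / 2) *
      ∑ j : Fin (2 * l), if variantMatrix (2 * l) a j = 1 then pairSeries (j / 2) else 0 := by
  rw [sum_variantMatrix_pairSeries]
  have ha := a.2
  obtain ⟨k, hk⟩ : ∃ k, k = (a : ℕ) / 2 := ⟨_, rfl⟩
  obtain ⟨p, hp⟩ : ∃ p, p = l - 1 - (a : ℕ) / 2 := ⟨_, rfl⟩
  rw [← hp, ← hk, show l + 1 = k + p + 2 by omega, pairSeries, pairSeries]
  have h2 : (C (1 / 2) : ℚ⟦X⟧) * 2 = 1 := by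
    rw [← map_ofNat (C (R := ℚ)) 2, ← map_mul]; norm_num
  have h4 : (C (1 / 4) : ℚ⟦X⟧) = C (1 / 2) * C (1 / 2) := by
    rw [← map_mul]; norm_num
  have h := invSqrtSeries_sq
  set w := invSqrtSeries
  rw [h4]
  set c : ℚ⟦X⟧ := C (1 / 2)
  -- the product of the two factors is `w ^ (k + p) * (1 - w ^ 2) / 4`, a multiple of `X`
  have hx : w ^ 2 * X = 1 - w ^ 2 := by linear_combination h
  linear_combination (-c * c * w ^ (k + p)) * hx - c * (w ^ k - w ^ (k + 1)) * w ^ p * h2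

theorem rootedSeries_subst (l : ℕ) (a : Fin (2 * l)) :
    (rootedSeries (variantMatrix (2 * l)) a).subst
      (X * (C (1 / 4) * invSqrtSeries ^ (l + 1))) = pairSeries (a / 2) := by
  set g : ℚ⟦X⟧ := X * (C (1 / 4) * invSqrtSeries ^ (l + 1)) with hg
  have hg0 : constantCoeff g = 0 := by simp [hg]
  have hs : HasSubst g := HasSubst.of_constantCoeff_zero' hg0
  refine congrFun (eq_of_system (variantMatrix (2 * l)) g
    (fun a => (rootedSeries (variantMatrix (2 * l)) a).subst g)
    (fun a => pairSeries (a / 2)) (fun i => ?_) (fun i => ?_) (fun i => ?_)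
    (fun i => pairSeries_eq l i)) a
  · exact constantCoeff_subst_eq_zero hg0 _ (constantCoeff_rootedSeries _ _)
  · simp [pairSeries, invSqrtSeries]
  · have := congrArg (substAlgHom (R := ℚ) hs) (rootedSeries_eq (variantMatrix (2 * l)) i)
    rw [map_add, map_mul, map_sum] at this
    simp only [apply_ite (substAlgHom (R := ℚ) hs), map_zero, coe_substAlgHom, subst_X hs] at this
    exact this

theorem sum_rootedSeries_subst (l : ℕ) :
    (∑ a, rootedSeries (variantMatrix (2 * l)) a).subst
      (X * (C (1 / 4) * invSqrtSeries ^ (l + 1))) = 1 - invSqrtSeries ^ l := by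
  have hs : HasSubst (X * (C (1 / 4) * invSqrtSeries ^ (l + 1)) : ℚ⟦X⟧) :=
    HasSubst.of_constantCoeff_zero' (by simp)
  rw [← coe_substAlgHom (R := ℚ) hs, map_sum]
  simp only [coe_substAlgHom, rootedSeries_subst]
  rw [← Finset.sum_range (fun b => pairSeries (b / 2)), sum_range_two_mul, ← sum_pairSeries]
  refine Finset.sum_congr rfl fun b _ => ?_
  rw [show 2 * b / 2 = b by omega, show (2 * b + 1) / 2 = b by omega]

/-! ### The coefficients of the total generating function -/

theorem derivative_one_sub_invSqrtSeries_pow (l : ℕ) :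
    d⁄dX ℚ (1 - invSqrtSeries ^ l) = C ((l : ℚ) / 2) * invSqrtSeries ^ (l + 2) := by
  rw [map_sub, derivative_one, derivative_pow, derivative_invSqrtSeries]
  rcases l with _ | l
  · simp
  · have hC : (C (((l + 1 : ℕ) : ℚ) / 2) : ℚ⟦X⟧) = ((l + 1 : ℕ) : ℚ⟦X⟧) * C (1 / 2) := by
      rw [← map_natCast (C (R := ℚ)) (l + 1), ← map_mul, mul_one_div]
    rw [hC, Nat.add_sub_cancel]
    ring

theorem mainTheorem1 (l n : ℕ) (hn : 1 ≤ n) :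
    (treeCount (variantMatrix (2 * l)) n : ℚ) =
      (l : ℚ) / (n : ℚ) * 2 ^ (2 * n - 1) *
        Ring.choose (((l : ℚ) + 1) / 2 * (n : ℚ) - (l : ℚ) / 2 - 1) (n - 1) := by
  obtain ⟨n, rfl⟩ := Nat.exists_eq_add_of_le' hn
  set φ : ℚ⟦X⟧ := C 4 * PowerSeries.binomialSeries ℚ (1 / 2 : ℚ) ^ (l + 1) with hφ
  have h : φ * (C (1 / 4) * invSqrtSeries ^ (l + 1)) = 1 := by
    have h1 : (C 4 * C (1 / 4) : ℚ⟦X⟧) = 1 := by rw [← map_mul]; norm_num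
    have h2 : PowerSeries.binomialSeries ℚ (1 / 2 : ℚ) * invSqrtSeries = 1 := by
      rw [invSqrtSeries, ← binomialSeries_add]; norm_num
    rw [hφ, mul_mul_mul_comm, h1, ← mul_pow, h2, one_pow, one_mul]
  have hT := lagrange_inversion h (∑ a, rootedSeries (variantMatrix (2 * l)) a) n
  have hc : coeff (n + 1) (∑ a, rootedSeries (variantMatrix (2 * l)) a) =
      (treeCount (variantMatrix (2 * l)) (n + 1) : ℚ) := by
    rw [treeCount_eq_sum_card_rootedTrees, map_sum]
    simp [rootedSeries]
  have hH : C ((l : ℚ) / 2) * invSqrtSeries ^ (l + 2) * φ ^ (n + 1) =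
      C ((l : ℚ) / 2 * 4 ^ (n + 1)) *
        PowerSeries.binomialSeries ℚ (((l : ℚ) + 1) / 2 * ((n + 1 : ℕ) : ℚ) - (l : ℚ) / 2 - 1) := by
    rw [hφ, mul_pow, ← pow_mul, invSqrtSeries, binomialSeries_pow, binomialSeries_pow,
      show C ((l : ℚ) / 2 * 4 ^ (n + 1)) = C ((l : ℚ) / 2) * C 4 ^ (n + 1) by simp,
      mul_mul_mul_comm, ← binomialSeries_add]
    congr 2
    push_cast
    ring
  rw [sum_rootedSeries_subst, derivative_one_sub_invSqrtSeries_pow, hH, hc, coeff_C_mul,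
    binomialSeries_coeff, smul_eq_mul, mul_one] at hT
  have hn0 : (n : ℚ) + 1 ≠ 0 := by positivity
  have h4 : (4 : ℚ) ^ (n + 1) = 2 * 2 ^ (2 * (n + 1) - 1) := by
    rw [← pow_succ', show 2 * (n + 1) - 1 + 1 = 2 * (n + 1) by omega, pow_mul]
    norm_num
  rw [h4] at hT
  rw [Nat.add_sub_cancel, Nat.cast_add_one] at *
  rw [div_mul_eq_mul_div, div_mul_eq_mul_div, eq_div_iff hn0, hT]
  ring
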